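/- Let $d\in\mathbb N$, $j\in\{0,1\}$, and let $s=(s_\alpha)_{\alpha=0}^{2d+j}$ be a real sequence whose Hankel matrix $\mathcal H(s)=(s_{\alpha+\beta})_{\alpha,\beta=0}^{d}$ is positive definite. For a real sequence $r=(r_\alpha)_{\alpha=0}^{N}$ and $t\in\mathbb R$ let $\mathfrak p_r(t)=(\mathfrak p_{r,\alpha}(t))_{\alpha=0}^{N}$ with $$\mathfrak p_{r,\alpha}(t)=\sum_{i=0}^{\lfloor\alpha/2\rfloor}\frac{\alpha!}{(\alpha-2i)!\,i!}\,r_{\alpha-2i}\,t^i ,$$ and for $t>0$ let $\Theta_t(x)=(4\pi t)^{-1/2}e^{-x^2/(4t)}$, $x\in\mathbb R$. Then $s$ can be extended to a real sequence $\tilde s=(s_\alpha)_{\alpha=0}^{2d+2}$ (by choosing $s_{2d+2}$ if $j=1$, and $s_{2d+1},s_{2d+2}$ if $j=0$) such that $\mathcal H(\tilde s)=(s_{\alpha+\beta})_{\alpha,\beta=0}^{d+1}$ is positive definite. For every such $\tilde s$ the following holds. The polynomial $t\mapsto\det\mathcal H(\mathfrak p_{\tilde s}(-t))$ has a smallest positive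 zero $\delta$. Moreover there are $k\le d+1$, $c_1,\dots,c_k>0$ and pairwise distinct $x_1,\dots,x_k\in\mathbb R$ such that $s$ is represented by the Gaussian mixture $\mu(x)=\sum_{i=1}^k c_i\,\Theta_\delta(x-x_i)$, that is, $$s_\alpha=\int_{\mathbb R}x^\alpha\mu(x)\,dx\qquad(\alpha=0,\dots,2d+j),$$ and such that, writing $f_v(x)=v_0+v_1x+\dots+v_{d+1}x^{d+1}$ for $v=(v_0,\dots,v_{d+1})\in\mathbb R^{d+2}$: every $x_i$ is a zero of $f_v$ for every $v\in\ker\mathcal H(\mathfrak p_{\tilde s}(-\delta))\setminus\{0\}$, and there is a $v\in\ker\mathcal H(\mathfrak p_{\tilde s}(-\delta))\setminus\{0\}$ for which $x_1,\dots,x_k$ are exactly the (complex) zeros of $f_v$. -/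

import Mathlib

namespace HeatMoments

open Polynomial MeasureTheory

noncomputable section

/-- The Hankel matrix `(s_{a+b})_{a,b=0}^m` of a real sequence `(s_0, …, s_{N-1})` of length
`N > 2m`. -/
def hankel (m : ℕ) {N : ℕ} (s : Fin N → ℝ) (h : 2 * m < N) :
    Matrix (Fin (m + 1)) (Fin (m + 1)) ℝ :=
  Matrix.of fun a b => s ⟨(a : ℕ) + (b : ℕ), by omega⟩

/-- The heat moment polynomials in one variable: for a real sequence `s = (s_0, …, s_{N-1})`
and `α < N`, the polynomial `∑_{i ≤ α/2} α! / ((α-2i)! i!) * s_{α-2i} * t^i` in `ℝ[t]`. It is the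
solution of `∂_t p_α = α (α-1) p_{α-2}` with initial value `p_α(0) = s_α`. -/
def heatPoly {N : ℕ} (s : Fin N → ℝ) (α : Fin N) : ℝ[X] :=
  ∑ i ∈ Finset.range ((α : ℕ) / 2 + 1),
    C (((α : ℕ).factorial : ℝ) / ((((α : ℕ) - 2 * i).factorial : ℝ) * (i.factorial : ℝ)) *
      s ⟨(α : ℕ) - 2 * i, by omega⟩) * X ^ i

/-- The sequence of values at time `t` of the heat moment polynomials of `s`. -/
def heatFlow {N : ℕ} (s : Fin N → ℝ) (t : ℝ) : Fin N → ℝ :=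
  fun α => (heatPoly s α).eval t

/-- The one-dimensional heat kernel `(4πt)^{-1/2} exp (-x²/(4t))`, for `t > 0`. -/
def heatKernel (t x : ℝ) : ℝ :=
  1 / Real.sqrt (4 * Real.pi * t) * Real.exp (-(x ^ 2 / (4 * t)))

/-- The Gaussian mixture, i.e. the measure on `ℝ` with Lebesgue density
`∑ i, c_i * heatKernel t (x - x_i)` (used for `t > 0` and positive `c_i`). -/
def gaussianMixture {k : ℕ} (t : ℝ) (c p : Fin k → ℝ) : Measure ℝ :=
  volume.withDensity fun x => ENNReal.ofReal (∑ i, c i * heatKernel t (x - p i))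

/-- The measure `μ` represents the truncated sequence `s`: all moments of the orders occurring in
`s` exist and agree with the entries of `s`. -/
def Represents {N : ℕ} (μ : Measure ℝ) (s : Fin N → ℝ) : Prop :=
  ∀ α : Fin N, Integrable (fun x : ℝ => x ^ (α : ℕ)) μ ∧ ∫ x, x ^ (α : ℕ) ∂μ = s α

/-- The polynomial `v_0 + v_1 x + ⋯ + v_m x^m` of a vector `v = (v_0, …, v_m)`. -/
def vecPoly {m : ℕ} (v : Fin (m + 1) → ℝ) : ℝ[X] :=
  ∑ i, C (v i) * X ^ (i : ℕ)

end

end HeatMoments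

/-!
The backward heat flow `t ↦ heatFlow s' (-t)` removes variance from the sequence, until its Hankel
matrix first becomes singular. The sequence is then, up to its top entry, that of an atomic measure,
and running the heat flow forward again turns the atoms into Gaussians.

* An extension with positive definite Hankel matrix exists since only the square of `X ^ (d + 1)`
  sees the free top moment, which may be taken large (`exists_update_pos`).
* The second moment `s₂ - 2 t s₀` vanishes at some `t > 0`, so positive definiteness is lost. At the
  first time `δ` at which this happens the Hankel matrix is positive semidefinite and singular, and
  `δ` is the least positive zero of the determinant (`exists_isLeast_det_eq_zero`).
* A degenerate positive semidefinite Hankel form of size `n + 1` is given, in degrees below `2 n`,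
  by a positive combination of point evaluations (`exists_gauss_quadrature`). Let `p` be a kernel
  polynomial of least degree. The form is definite below the degree of `p`, to which `p` is
  orthogonal, and this forces the zeros of `p` to be real and simple. They are the nodes of a Gauss
  quadrature with positive weights; testing a kernel polynomial against the Lagrange basis shows
  that it vanishes at the nodes. Here `n = d + 1`, so the moments up to order `2 d + 1` are
  reproduced; the top one may be lost.
* On exponential generating functions the heat flow is multiplication by `exp (t X²)`
  (`heatFlow_eq_coeff`), hence injective. The moments of the heat kernel at time `δ` centred at `a`
  have generating function `exp (a X + δ X²)`, so they flow back to the moments of the point mass at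
  `a` (`coeff_heatSeries_neg_mul_egf_gaussianMoment`). Thus replacing each atom by a heat kernel at
  time `δ` undoes the backward flow (`eq_sum_gaussianMoment`).
-/

namespace HeatMoments

open Polynomial MeasureTheory

/-! ### Positive semidefinite functionals and Gauss quadrature -/

/-- The radical, among the polynomials of degree at most `n`, of the bilinear form
`(f, g) ↦ L (f * g)`. -/
def IsInRadical (L : ℝ[X] →ₗ[ℝ] ℝ) (n : ℕ) (f : ℝ[X]) : Prop :=
  f.natDegree ≤ n ∧ ∀ g : ℝ[X], g.natDegree ≤ n → L (f * g) = 0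

variable {L : ℝ[X] →ₗ[ℝ] ℝ} {n : ℕ}

lemma map_C_mul (L : ℝ[X] →ₗ[ℝ] ℝ) (a : ℝ) (f : ℝ[X]) : L (C a * f) = a * L f := by
  rw [C_mul', map_smul, smul_eq_mul]

/-- Isotropic vectors of a positive semidefinite form lie in its radical. -/
lemma isInRadical_of_isotropic (hL : ∀ f : ℝ[X], f.natDegree ≤ n → 0 ≤ L (f * f))
    {f : ℝ[X]} (hf : f.natDegree ≤ n) (h0 : L (f * f) = 0) : IsInRadical L n f := by
  refine ⟨hf, fun g hg => ?_⟩
  by_contra hne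
  -- otherwise `L ((g + t f)²) = L (g²) + 2 t L (f g)` takes the value `-1`
  set t : ℝ := -(L (g * g) + 1) / (2 * L (f * g)) with ht
  have h1 := hL (g + C t * f) (natDegree_add_le_of_degree_le hg
    ((natDegree_C_mul_le t f).trans hf))
  have h2 : (g + C t * f) * (g + C t * f)
      = g * g + (C (2 * t) * (f * g) + C (t * t) * (f * f)) := by
    simp only [C_mul, map_ofNat]; ring
  rw [h2, map_add, map_add, map_C_mul, map_C_mul, h0] at h1
  have h3 : 2 * t * L (f * g) = -(L (g * g) + 1) := by rw [ht]; field_simp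
  linarith

lemma IsInRadical.X_mul (hL : ∀ f : ℝ[X], f.natDegree ≤ n → 0 ≤ L (f * f)) {f : ℝ[X]}
    (hf : IsInRadical L n f) (hdeg : f.natDegree + 1 < n) : IsInRadical L n (X * f) := by
  have h1 : (X * f).natDegree ≤ f.natDegree + 1 := by
    have := natDegree_mul_le (p := (X : ℝ[X])) (q := f)
    rw [natDegree_X] at this
    omega
  refine isInRadical_of_isotropic hL (by omega) ?_
  rw [show X * f * (X * f) = f * (X * (X * f)) by ring]
  refine hf.2 _ ?_
  have := natDegree_mul_le (p := (X : ℝ[X])) (q := X * f)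
  rw [natDegree_X] at this
  omega

/-- `L` vanishes on all multiples, of degree below `2 n`, of an element of the radical. -/
lemma IsInRadical.map_mul_eq_zero (hL : ∀ f : ℝ[X], f.natDegree ≤ n → 0 ≤ L (f * f)) {f : ℝ[X]}
    (hf : IsInRadical L n f) {q : ℝ[X]} (hq : f.natDegree + q.natDegree < 2 * n) :
    L (f * q) = 0 := by
  have hX : ∀ i, f.natDegree + i < n → IsInRadical L n (X ^ i * f) := by
    intro i
    induction i with
    | zero => intro _; simpa using hf
    | succ i ih =>
      intro hi
      rw [pow_succ', mul_assoc]
      refine (ih (by omega)).X_mul hL ?_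
      have := natDegree_mul_le (p := (X : ℝ[X]) ^ i) (q := f)
      rw [natDegree_X_pow] at this
      omega
  have hm : ∀ m, f.natDegree + m < 2 * n → L (f * X ^ m) = 0 := by
    intro m hm
    have hn := hf.1
    -- split `X ^ m` between the two factors
    obtain ⟨i, e, rfl, hi, he⟩ : ∃ i e, m = i + e ∧ (i = 0 ∨ f.natDegree + i < n) ∧ e ≤ n := by
      rcases le_or_gt m n with h | h
      · exact ⟨0, m, by omega, Or.inl rfl, h⟩
      · exact ⟨m - n, n, by omega, Or.inr (by omega), le_rfl⟩
    have h1 : IsInRadical L n (X ^ i * f) := by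
      rcases hi with rfl | hi
      · simpa using hf
      · exact hX i hi
    have := h1.2 (X ^ e) (by simpa using he)
    rwa [show f * X ^ (i + e) = X ^ i * f * X ^ e by ring]
  conv_lhs => rw [q.as_sum_range_C_mul_X_pow, Finset.mul_sum, map_sum]
  refine Finset.sum_eq_zero fun m hmem => ?_
  rw [Finset.mem_range] at hmem
  rw [mul_left_comm, map_C_mul, hm m (by omega), mul_zero]

/-- A polynomial orthogonal to lower degrees has no factor `(X - a)² + b²`: testing it against the
complementary factor `q` would give `L (((X - a) q)²) + b² L (q²) > 0`. This excludes both
non-real and multiple zeros. -/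
lemma not_quadratic_dvd {p : ℝ[X]} (hp0 : p ≠ 0)
    (hpos : ∀ q : ℝ[X], q ≠ 0 → q.natDegree < p.natDegree → 0 < L (q * q))
    (horth : ∀ q : ℝ[X], q.natDegree < p.natDegree → L (p * q) = 0) (a b : ℝ) :
    ¬ ((X - C a) ^ 2 + C (b ^ 2)) ∣ p := by
  rintro ⟨q, hq⟩
  have hq0 : q ≠ 0 := by rintro rfl; simp [hq] at hp0
  have hdeg : p.natDegree = 2 + q.natDegree := by
    have h2 : ((X - C a) ^ 2 + C (b ^ 2)).natDegree = 2 := by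
      rw [natDegree_add_C, natDegree_pow, natDegree_X_sub_C]
    have h3 : ((X - C a) ^ 2 + C (b ^ 2)) ≠ 0 := by
      intro h; rw [h] at h2; simp at h2
    rw [hq, natDegree_mul h3 hq0, h2]
  have h1 : ((X - C a) * q).natDegree = 1 + q.natDegree := by
    rw [natDegree_mul (X_sub_C_ne_zero a) hq0, natDegree_X_sub_C]
  have h2 := hpos ((X - C a) * q) (mul_ne_zero (X_sub_C_ne_zero a) hq0) (by omega)
  have h3 := hpos q hq0 (by omega)
  have h4 := horth q (by omega)
  rw [hq, show ((X - C a) ^ 2 + C (b ^ 2)) * q * q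
    = (X - C a) * q * ((X - C a) * q) + C (b ^ 2) * (q * q) by ring, map_add, map_C_mul] at h4
  nlinarith [mul_nonneg (sq_nonneg b) h3.le]

lemma splits_of_forall_not_quadratic_dvd {p : ℝ[X]}
    (h : ∀ a b : ℝ, ¬ ((X - C a) ^ 2 + C (b ^ 2)) ∣ p) : p.Splits := by
  refine Splits.of_splits_map (algebraMap ℝ ℂ) (IsAlgClosed.splits _) fun z hz => ?_
  have hz0 : aeval z p = 0 := by
    rw [mem_roots', IsRoot.def, eval_map_algebraMap] at hz
    exact hz.2
  by_contra hne
  have him : z.im ≠ 0 := fun h0 => hne ⟨z.re, by apply Complex.ext <;> simp [h0]⟩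
  refine h z.re z.im ?_
  convert p.quadratic_dvd_of_aeval_eq_zero_im_ne_zero hz0 him using 1
  rw [← Complex.normSq_eq_norm_sq, Complex.normSq_apply]
  simp only [C_mul, C_add, C_pow, map_ofNat]
  ring

lemma nodup_roots_of_forall_not_quadratic_dvd {p : ℝ[X]} (hp0 : p ≠ 0)
    (h : ∀ a b : ℝ, ¬ ((X - C a) ^ 2 + C (b ^ 2)) ∣ p) : p.roots.Nodup := by
  rw [Multiset.nodup_iff_count_le_one]
  intro a
  rw [count_roots]
  by_contra hlt
  push Not at hlt
  refine h a 0 ?_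
  have := (le_rootMultiplicity_iff hp0).1 (show 2 ≤ p.rootMultiplicity a from hlt)
  simpa using this

/-- Gauss quadrature for a degenerate positive semidefinite functional: below degree `2 n`, the
functional is a positive combination of evaluations at the (real, simple) zeros of a polynomial
in the radical. -/
theorem exists_gauss_quadrature (hL : ∀ f : ℝ[X], f.natDegree ≤ n → 0 ≤ L (f * f))
    (hrad : ∃ f : ℝ[X], f ≠ 0 ∧ IsInRadical L n f) :
    ∃ (S : Finset ℝ) (c : ℝ → ℝ), S.card ≤ n ∧ IsInRadical L n (∏ a ∈ S, (X - C a)) ∧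
      (∀ a ∈ S, 0 < c a) ∧
      (∀ f : ℝ[X], f.natDegree < 2 * n → L f = ∑ a ∈ S, c a * f.eval a) ∧
      (∀ f : ℝ[X], IsInRadical L n f → ∀ a ∈ S, f.eval a = 0) := by
  classical
  -- `p` is a monic element of the radical of least degree
  have hex : ∃ k, ∃ f : ℝ[X], f ≠ 0 ∧ IsInRadical L n f ∧ f.natDegree = k := by
    obtain ⟨f, h0, h1⟩ := hrad
    exact ⟨_, f, h0, h1, rfl⟩
  obtain ⟨f, hf0, hf, hfk⟩ := Nat.find_spec hex
  have hmin : ∀ q : ℝ[X], q ≠ 0 → IsInRadical L n q → f.natDegree ≤ q.natDegree := by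
    intro q hq0 hq
    rw [hfk]
    exact Nat.find_min' hex ⟨q, hq0, hq, rfl⟩
  obtain ⟨p, hpm, hpd, hp⟩ : ∃ p : ℝ[X], p.Monic ∧ p.natDegree = f.natDegree ∧
      IsInRadical L n p := by
    have hlc := leadingCoeff_ne_zero.2 hf0
    refine ⟨C f.leadingCoeff⁻¹ * f, ?_, natDegree_C_mul (inv_ne_zero hlc), ?_, fun g hg => ?_⟩
    · rw [Monic, leadingCoeff_mul, leadingCoeff_C, inv_mul_cancel₀ hlc]
    · exact (natDegree_C_mul_le _ f).trans hf.1
    · rw [mul_assoc, map_C_mul, hf.2 g hg, mul_zero]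
  rw [← hpd] at hmin
  have hkn := hp.1
  have hpos : ∀ q : ℝ[X], q ≠ 0 → q.natDegree < p.natDegree → 0 < L (q * q) := by
    intro q hq0 hq
    refine lt_of_le_of_ne (hL q (by omega)) fun h0 => ?_
    have := hmin q hq0 (isInRadical_of_isotropic hL (by omega) h0.symm)
    omega
  have hquad := not_quadratic_dvd hpm.ne_zero hpos fun q hq => hp.2 q (by omega)
  have hsplit := splits_of_forall_not_quadratic_dvd hquad
  have hnodup := nodup_roots_of_forall_not_quadratic_dvd hpm.ne_zero hquad
  set S := p.roots.toFinset with hS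
  have hcard : S.card = p.natDegree := by
    rw [hS, Multiset.toFinset_card_of_nodup hnodup, hsplit.natDegree_eq_card_roots]
  have hprod : ∏ a ∈ S, (X - C a) = p := by
    conv_rhs => rw [hsplit.eq_prod_roots_of_monic hpm]
    rw [Finset.prod_eq_multiset_prod, hS, Multiset.toFinset_val, hnodup.dedup]
  have hroot : ∀ a ∈ S, p.eval a = 0 := fun a ha => by
    rw [hS, Multiset.mem_toFinset, mem_roots'] at ha
    exact ha.2
  have hinj : Set.InjOn (id : ℝ → ℝ) S := Function.injective_id.injOn
  -- the weights are the values of `L` at the Lagrange basis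
  let c : ℝ → ℝ := fun a => L (Lagrange.basis S id a)
  have hform : ∀ f : ℝ[X], f.natDegree < 2 * n → L f = ∑ a ∈ S, c a * f.eval a := by
    intro f hf
    have h1 : L f = L (f %ₘ p) := by
      have hdiv := modByMonic_add_div f p
      conv_lhs => rw [← hdiv]
      rw [map_add, add_eq_left]
      refine hp.map_mul_eq_zero hL ?_
      rw [natDegree_divByMonic f hpm]
      omega
    have h2 : f %ₘ p = ∑ a ∈ S, C (f.eval a) * Lagrange.basis S id a := by
      have hdeg : (f %ₘ p).degree < S.card := by
        rw [hcard, ← degree_eq_natDegree hpm.ne_zero]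
        exact degree_modByMonic_lt f hpm
      rw [Lagrange.eq_interpolate hinj hdeg, Lagrange.interpolate_apply]
      refine Finset.sum_congr rfl fun a ha => ?_
      rw [id, modByMonic_eq_sub_mul_div, eval_sub, eval_mul, hroot a ha, zero_mul, sub_zero]
    rw [h1, h2, map_sum]
    exact Finset.sum_congr rfl fun a _ => by rw [map_C_mul, mul_comm]
  have hbdeg : ∀ a ∈ S, (Lagrange.basis S id a).natDegree + 1 = p.natDegree := fun a ha => by
    rw [Lagrange.natDegree_basis hinj ha, ← hcard]
    have := Finset.card_pos.2 ⟨a, ha⟩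
    omega
  have hsum : ∀ g : ℝ[X], ∀ a ∈ S,
      ∑ b ∈ S, c b * (g * Lagrange.basis S id a).eval b = c a * g.eval a := by
    intro g a ha
    rw [Finset.sum_eq_single a]
    · have := Lagrange.eval_basis_self hinj ha
      rw [id] at this
      rw [eval_mul, this, mul_one]
    · intro b hb hba
      have := Lagrange.eval_basis_of_ne (v := (id : ℝ → ℝ)) hba.symm hb
      rw [id] at this
      rw [eval_mul, this, mul_zero, mul_zero]
    · exact fun h => absurd ha h
  have hc : ∀ a ∈ S, 0 < c a := by
    intro a ha
    have hd := hbdeg a ha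
    have h1 := hpos (Lagrange.basis S id a) (Lagrange.basis_ne_zero hinj ha) (by omega)
    rw [hform _ (natDegree_mul_le.trans_lt (by omega)), hsum _ a ha] at h1
    have := Lagrange.eval_basis_self hinj ha
    rw [id] at this
    rwa [this, mul_one] at h1
  refine ⟨S, c, by omega, hprod ▸ hp, hc, hform, fun g hg a ha => ?_⟩
  -- test `g` against the Lagrange basis polynomial at `a`
  have hd := hbdeg a ha
  have hgn := hg.1
  have h1 := hg.2 (Lagrange.basis S id a) (by omega)
  rw [hform _ (natDegree_mul_le.trans_lt (by omega)), hsum _ a ha] at h1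
  exact (mul_eq_zero.1 h1).resolve_left (hc a ha).ne'

/-! ### Hankel matrices and the Riesz functional -/

/-- The Riesz functional of a sequence: the linear functional on `ℝ[X]` with `X ^ n ↦ u n`. -/
noncomputable def riesz (u : ℕ → ℝ) : ℝ[X] →ₗ[ℝ] ℝ :=
  lsum fun n => u n • LinearMap.id

lemma riesz_apply (u : ℕ → ℝ) (f : ℝ[X]) : riesz u f = f.sum fun n a => u n * a := rfl

lemma riesz_X_pow (u : ℕ → ℝ) (n : ℕ) : riesz u (X ^ n) = u n := by
  rw [riesz_apply, ← monomial_one_right_eq_X_pow, sum_monomial_index _ (fun n a => u n * a) (mul_zero _),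
    mul_one]

lemma riesz_congr {u w : ℕ → ℝ} {f : ℝ[X]} (h : ∀ n ≤ f.natDegree, u n = w n) :
    riesz u f = riesz w f := by
  rw [riesz_apply, riesz_apply, Polynomial.sum_def, Polynomial.sum_def]
  exact Finset.sum_congr rfl fun n hn => by rw [h n (le_natDegree_of_mem_supp n hn)]

/-- The extension by zero of a finite sequence. -/
noncomputable def extendSeq {N : ℕ} (s : Fin N → ℝ) (n : ℕ) : ℝ :=
  if h : n < N then s ⟨n, h⟩ else 0

lemma extendSeq_of_lt {N : ℕ} (s : Fin N → ℝ) {n : ℕ} (h : n < N) :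
    extendSeq s n = s ⟨n, h⟩ := dif_pos h

lemma natDegree_vecPoly_le {m : ℕ} (v : Fin (m + 1) → ℝ) : (vecPoly v).natDegree ≤ m :=
  natDegree_sum_le_of_forall_le _ _ fun i _ => (natDegree_C_mul_X_pow_le _ _).trans (by omega)

lemma vecPoly_coeff {m : ℕ} (f : ℝ[X]) (hf : f.natDegree ≤ m) :
    vecPoly (fun i : Fin (m + 1) => f.coeff i) = f := by
  rw [vecPoly, Fin.sum_univ_eq_sum_range (fun i => C (f.coeff i) * X ^ i)]
  exact (f.as_sum_range_C_mul_X_pow' (by omega)).symm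

lemma coeff_vecPoly {m : ℕ} (v : Fin (m + 1) → ℝ) (i : Fin (m + 1)) :
    (vecPoly v).coeff i = v i := by
  simp [vecPoly, finsetSum_coeff, coeff_C_mul, coeff_X_pow, Fin.val_inj]

lemma vecPoly_ne_zero {m : ℕ} {v : Fin (m + 1) → ℝ} (hv : v ≠ 0) : vecPoly v ≠ 0 := by
  contrapose! hv
  ext i
  rw [← coeff_vecPoly v i, hv, coeff_zero, Pi.zero_apply]

lemma hankel_mulVec {m N : ℕ} (s : Fin N → ℝ) (h : 2 * m < N) (v : Fin (m + 1) → ℝ)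
    (a : Fin (m + 1)) :
    (hankel m s h).mulVec v a = riesz (extendSeq s) (X ^ (a : ℕ) * vecPoly v) := by
  rw [vecPoly, Finset.mul_sum, map_sum, Matrix.mulVec, dotProduct]
  refine Finset.sum_congr rfl fun b _ => ?_
  rw [mul_left_comm, map_C_mul, ← pow_add, riesz_X_pow, extendSeq_of_lt s (by omega), mul_comm]
  rfl

lemma dotProduct_hankel_mulVec {m N : ℕ} (s : Fin N → ℝ) (h : 2 * m < N)
    (w v : Fin (m + 1) → ℝ) :
    w ⬝ᵥ (hankel m s h).mulVec v = riesz (extendSeq s) (vecPoly w * vecPoly v) := by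
  conv_rhs => rw [vecPoly, Finset.sum_mul, map_sum]
  refine Finset.sum_congr rfl fun a _ => ?_
  rw [hankel_mulVec, mul_assoc, map_C_mul]

lemma isHermitian_hankel {m N : ℕ} (s : Fin N → ℝ) (h : 2 * m < N) :
    (hankel m s h).IsHermitian := by
  ext a b
  simp [hankel, add_comm]

lemma posDef_hankel_iff {m N : ℕ} (s : Fin N → ℝ) (h : 2 * m < N) :
    (hankel m s h).PosDef ↔
      ∀ f : ℝ[X], f ≠ 0 → f.natDegree ≤ m → 0 < riesz (extendSeq s) (f * f) := by
  constructor
  · intro hp f hf0 hf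
    have h1 := hp.dotProduct_mulVec_pos (x := fun i : Fin (m + 1) => f.coeff i) fun h0 => hf0 (by
      rw [← vecPoly_coeff f hf, h0]; simp [vecPoly])
    rwa [star_trivial, dotProduct_hankel_mulVec, vecPoly_coeff f hf] at h1
  · intro hp
    refine .of_dotProduct_mulVec_pos (isHermitian_hankel s h) fun v hv => ?_
    rw [star_trivial, dotProduct_hankel_mulVec]
    exact hp _ (vecPoly_ne_zero hv) (natDegree_vecPoly_le v)

lemma hankel_mulVec_eq_zero_iff {m N : ℕ} (s : Fin N → ℝ) (h : 2 * m < N)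
    (v : Fin (m + 1) → ℝ) :
    (hankel m s h).mulVec v = 0 ↔ IsInRadical (riesz (extendSeq s)) m (vecPoly v) := by
  constructor
  · refine fun h0 => ⟨natDegree_vecPoly_le v, fun g hg => ?_⟩
    rw [mul_comm, ← vecPoly_coeff g hg, ← dotProduct_hankel_mulVec s h, h0, dotProduct_zero]
  · intro hr
    ext a
    rw [hankel_mulVec, mul_comm, Pi.zero_apply]
    exact hr.2 _ (by rw [natDegree_X_pow]; omega)

/-- Positive definiteness extends to the next degree once the new top moment is large enough: the
bound is the square of the projection of `X ^ (d + 1)` to the polynomials of degree at most `d`. -/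
lemma exists_update_pos {d N : ℕ} (s : Fin N → ℝ) (h : 2 * d < N) (hs : (hankel d s h).PosDef) :
    ∃ M : ℝ, ∀ f : ℝ[X], f ≠ 0 → f.natDegree ≤ d + 1 →
      0 < riesz (Function.update (extendSeq s) (2 * d + 2) M) (f * f) := by
  obtain ⟨v, hv⟩ : ∃ v, (hankel d s h).mulVec v
      = fun a : Fin (d + 1) => extendSeq s (d + 1 + (a : ℕ)) :=
    Matrix.mulVec_surjective_iff_isUnit.2 hs.isUnit _
  set w := vecPoly v with hw
  have hwd : w.natDegree ≤ d := natDegree_vecPoly_le v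
  let M : ℝ := riesz (extendSeq s) (w * w) + 1
  refine ⟨M, fun f hf0 hf => ?_⟩
  set R := riesz (Function.update (extendSeq s) (2 * d + 2) M) with hR
  have hlow : ∀ g : ℝ[X], g.natDegree ≤ 2 * d + 1 → R g = riesz (extendSeq s) g := fun g hg =>
    riesz_congr fun n hn => Function.update_of_ne (by omega) _ _
  have hpos : ∀ g : ℝ[X], g ≠ 0 → g.natDegree ≤ d → 0 < R (g * g) := fun g hg0 hg => by
    rw [hlow _ (natDegree_mul_le.trans (by omega))]
    exact (posDef_hankel_iff s h).1 hs g hg0 hg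
  have hrep : ∀ g : ℝ[X], g.natDegree ≤ d → R (X ^ (d + 1) * g) = R (w * g) := fun g hg => by
    have h1 : (X ^ (d + 1) * g).natDegree ≤ 2 * d + 1 :=
      natDegree_mul_le.trans (by rw [natDegree_X_pow]; omega)
    rw [hlow _ h1, hlow _ (natDegree_mul_le.trans (by omega)), mul_comm w,
      ← vecPoly_coeff g hg, hw, ← dotProduct_hankel_mulVec s h, hv]
    conv_lhs => rw [vecPoly, Finset.mul_sum, map_sum]
    refine Finset.sum_congr rfl fun a _ => ?_
    rw [mul_left_comm, map_C_mul, ← pow_add, riesz_X_pow]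
  have htop : R (X ^ (d + 1) * X ^ (d + 1)) = R (w * w) + 1 := by
    rw [← pow_add, hR, riesz_X_pow, show d + 1 + (d + 1) = 2 * d + 2 by ring,
      Function.update_self, ← hR, hlow _ (natDegree_mul_le.trans (by omega))]
  -- split off the top coefficient `a` of `f`
  set a := f.coeff (d + 1) with ha
  set g := f - C a * X ^ (d + 1) with hg
  have hgd : g.natDegree ≤ d := by
    rw [natDegree_le_iff_coeff_eq_zero]
    intro n hn
    rw [hg, coeff_sub, coeff_C_mul, coeff_X_pow]
    rcases eq_or_ne n (d + 1) with rfl | hne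
    · simp [ha]
    · rw [if_neg hne, coeff_eq_zero_of_natDegree_lt (by omega)]; simp
  have hfg : f = C a * X ^ (d + 1) + g := by rw [hg]; ring
  have key : R (f * f) = a ^ 2 + R ((C a * w + g) * (C a * w + g)) := by
    rw [hfg, show (C a * X ^ (d + 1) + g) * (C a * X ^ (d + 1) + g)
        = C (a * a) * (X ^ (d + 1) * X ^ (d + 1)) + (C (2 * a) * (X ^ (d + 1) * g) + g * g) by
          simp only [C_mul, map_ofNat]; ring,
      show (C a * w + g) * (C a * w + g)
        = C (a * a) * (w * w) + (C (2 * a) * (w * g) + g * g) by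
          simp only [C_mul, map_ofNat]; ring]
    simp only [map_add, map_C_mul, htop, hrep g hgd]
    ring
  rw [key]
  rcases eq_or_ne (C a * w + g) 0 with h0 | h0
  · have ha0 : a ≠ 0 := by
      rintro h1
      rw [h1, C_0, zero_mul, zero_add] at h0 hfg
      exact hf0 (hfg.trans h0)
    rw [h0, mul_zero, map_zero, add_zero]
    positivity
  · have := hpos _ h0 (natDegree_add_le_of_degree_le ((natDegree_C_mul_le _ _).trans hwd) hgd)
    positivity

lemma exists_posDef_extension {d N : ℕ} (s : Fin N → ℝ) (h : 2 * d < N) (hN : N ≤ 2 * d + 2)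
    (hs : (hankel d s h).PosDef) :
    ∃ s' : Fin (2 * d + 3) → ℝ, (∀ α : Fin N, s' (Fin.castLE (by omega) α) = s α) ∧
      (hankel (d + 1) s' (by omega)).PosDef := by
  obtain ⟨M, hM⟩ := exists_update_pos s h hs
  refine ⟨fun i => Function.update (extendSeq s) (2 * d + 2) M i, fun α => ?_, ?_⟩
  · have hα := α.2
    simp only [Fin.val_castLE]
    rw [Function.update_of_ne (by omega), extendSeq_of_lt s hα]
  · rw [posDef_hankel_iff]
    intro f hf0 hf
    rw [riesz_congr (w := Function.update (extendSeq s) (2 * d + 2) M)]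
    · exact hM f hf0 hf
    · intro n hn
      have := natDegree_mul_le (p := f) (q := f)
      rw [extendSeq_of_lt _ (by omega)]

/-! ### The heat flow on exponential generating functions -/

/-- The exponential generating function of a sequence. -/
noncomputable def egf (u : ℕ → ℝ) : PowerSeries ℝ :=
  PowerSeries.mk fun n => u n / (n.factorial : ℝ)

/-- The power series `exp (t X²)`. -/
noncomputable def heatSeries (t : ℝ) : PowerSeries ℝ :=
  PowerSeries.mk fun n => if Even n then t ^ (n / 2) / ((n / 2).factorial : ℝ) else 0

lemma constantCoeff_heatSeries (t : ℝ) : PowerSeries.constantCoeff (heatSeries t) = 1 := by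
  rw [← PowerSeries.coeff_zero_eq_constantCoeff_apply, heatSeries, PowerSeries.coeff_mk]
  simp

lemma derivative_heatSeries (t : ℝ) :
    PowerSeries.derivative ℝ (heatSeries t)
      = PowerSeries.C (2 * t) * PowerSeries.X * heatSeries t := by
  ext n
  rw [PowerSeries.coeff_derivative, mul_assoc, PowerSeries.coeff_C_mul]
  rcases n with _ | n
  · simp [heatSeries]
  · rw [PowerSeries.coeff_succ_X_mul, heatSeries, PowerSeries.coeff_mk, PowerSeries.coeff_mk]
    rcases Nat.even_or_odd' n with ⟨i, rfl | rfl⟩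
    · rw [if_pos ⟨i + 1, by ring⟩, if_pos ⟨i, by ring⟩, show (2 * i + 1 + 1) / 2 = i + 1 by omega,
        show 2 * i / 2 = i by omega, Nat.factorial_succ]
      push_cast
      field_simp
      ring
    · rw [if_neg (by simp [parity_simps]), if_neg (by simp [parity_simps])]
      ring

/-- The heat flow multiplies the exponential generating function by `exp (t X²)`. -/
lemma heatFlow_eq_coeff {N : ℕ} (s : Fin N → ℝ) (t : ℝ) (α : Fin N) :
    heatFlow s t α = ((α : ℕ).factorial : ℝ) *
      PowerSeries.coeff (α : ℕ) (heatSeries t * egf (extendSeq s)) := by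
  have hα := α.2
  rw [PowerSeries.coeff_mul, Finset.Nat.sum_antidiagonal_eq_sum_range_succ_mk, heatFlow, heatPoly,
    eval_finsetSum, Finset.mul_sum]
  refine Finset.sum_of_injOn (fun i => 2 * i) (fun a _ b _ h => by simpa using h)
    (fun i hi => ?_) (fun n _ hn => ?_) (fun i hi => ?_)
  · simp only [Finset.coe_range, Set.mem_Iio] at hi ⊢
    omega
  · rw [heatSeries, PowerSeries.coeff_mk, if_neg, zero_mul, mul_zero]
    rintro ⟨i, rfl⟩
    refine hn ⟨i, ?_, by simp only; ring⟩
    simp only [Finset.coe_range, Set.mem_Iio, Finset.mem_range] at *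
    omega
  · simp only [Finset.mem_range] at hi
    rw [heatSeries, egf, PowerSeries.coeff_mk, PowerSeries.coeff_mk, if_pos ⟨i, by ring⟩,
      show 2 * i / 2 = i by omega, extendSeq_of_lt s (show (α : ℕ) - 2 * i < N by omega)]
    simp only [eval_mul, eval_C, eval_pow, eval_X]
    field_simp

/-- The heat flow on initial segments is injective, as `exp (t X²)` is a unit. -/
lemma eq_of_coeff_heatSeries_mul_egf_eq {t : ℝ} {N : ℕ} {u w : ℕ → ℝ}
    (h : ∀ n < N, PowerSeries.coeff n (heatSeries t * egf u)
      = PowerSeries.coeff n (heatSeries t * egf w)) {n : ℕ} (hn : n < N) : u n = w n := by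
  have hu : IsUnit (heatSeries t) := by
    rw [PowerSeries.isUnit_iff_constantCoeff, constantCoeff_heatSeries]
    exact isUnit_one
  have h1 : (PowerSeries.X : PowerSeries ℝ) ^ N ∣ heatSeries t * (egf u - egf w) := by
    rw [PowerSeries.X_pow_dvd_iff]
    intro m hm
    rw [mul_sub, map_sub, h m hm, sub_self]
  rw [hu.dvd_mul_left, PowerSeries.X_pow_dvd_iff] at h1
  have h2 := h1 n hn
  rw [map_sub, egf, egf, PowerSeries.coeff_mk, PowerSeries.coeff_mk, ← sub_div,
    div_eq_zero_iff] at h2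
  exact sub_eq_zero.1 (h2.resolve_right (by positivity))

/-! ### Moments of Gaussian mixtures -/

/-- The moments of the Gaussian with mean `a` and variance `2 δ`, i.e. of the heat kernel at time
`δ` centred at `a`. -/
noncomputable def gaussianMoment (a : ℝ) (δ : NNReal) (n : ℕ) : ℝ :=
  ∫ x, x ^ n ∂(ProbabilityTheory.gaussianReal a (2 * δ))

lemma iteratedDeriv_succ_exp_quadratic (a δ : ℝ) (n : ℕ) (t : ℝ) :
    iteratedDeriv (n + 1) (fun t : ℝ => Real.exp (a * t + δ * t ^ 2)) t
      = (a + 2 * δ * t) * iteratedDeriv n (fun t : ℝ => Real.exp (a * t + δ * t ^ 2)) t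
        + 2 * δ * n * iteratedDeriv (n - 1) (fun t : ℝ => Real.exp (a * t + δ * t ^ 2)) t := by
  set F := fun t : ℝ => Real.exp (a * t + δ * t ^ 2) with hF
  have hsm : ContDiff ℝ ⊤ F := by rw [hF]; fun_prop
  have hd : ∀ m, Differentiable ℝ (iteratedDeriv m F) := fun m =>
    hsm.differentiable_iteratedDeriv m (by exact_mod_cast WithTop.coe_lt_top _)
  have hder : ∀ m t, HasDerivAt (iteratedDeriv m F) (iteratedDeriv (m + 1) F t) t := fun m t => by
    rw [iteratedDeriv_succ]
    exact (hd m t).hasDerivAt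
  have hlin : ∀ t, HasDerivAt (fun t : ℝ => a + 2 * δ * t) (2 * δ) t := fun t => by
    simpa using ((hasDerivAt_id t).const_mul (2 * δ)).const_add a
  induction n generalizing t with
  | zero =>
    rw [zero_add, iteratedDeriv_one, iteratedDeriv_zero]
    have h1 : HasDerivAt (fun t : ℝ => a * t + δ * t ^ 2) (a + 2 * δ * t) t := by
      have := ((hasDerivAt_id t).const_mul a).add ((hasDerivAt_pow 2 t).const_mul δ)
      refine this.congr_deriv ?_
      simp; ring
    rw [hF, h1.exp.deriv]
    simp; ring
  | succ n ih =>
    have h1 := ((hlin t).mul (hder n t)).add ((hder (n - 1) t).const_mul (2 * δ * n))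
    rw [iteratedDeriv_succ]
    refine ((congrArg (fun G => deriv G t) (funext ih)).trans h1.deriv).trans ?_
    rcases n with _ | n
    · simp; ring
    · simp only [Nat.add_sub_cancel]
      push_cast
      ring

lemma gaussianMoment_eq_iteratedDeriv (a : ℝ) (δ : NNReal) (n : ℕ) :
    gaussianMoment a δ n
      = iteratedDeriv n (fun t : ℝ => Real.exp (a * t + δ * t ^ 2)) 0 := by
  have h := ProbabilityTheory.iteratedDeriv_mgf_zero (X := id)
    (μ := ProbabilityTheory.gaussianReal a (2 * δ)) (by simp) n
  rw [ProbabilityTheory.mgf_id_gaussianReal] at h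
  rw [gaussianMoment]
  refine (h.symm.trans ?_)
  congr 1
  ext t
  push_cast
  congr 1
  ring

lemma gaussianMoment_zero (a : ℝ) (δ : NNReal) : gaussianMoment a δ 0 = 1 := by
  simp [gaussianMoment]

lemma gaussianMoment_succ (a : ℝ) (δ : NNReal) (n : ℕ) :
    gaussianMoment a δ (n + 1)
      = a * gaussianMoment a δ n + 2 * δ * n * gaussianMoment a δ (n - 1) := by
  simp only [gaussianMoment_eq_iteratedDeriv]
  rw [iteratedDeriv_succ_exp_quadratic]
  simp

lemma derivative_egf_gaussianMoment (a : ℝ) (δ : NNReal) :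
    PowerSeries.derivative ℝ (egf (gaussianMoment a δ))
      = (PowerSeries.C a + PowerSeries.C (2 * (δ : ℝ)) * PowerSeries.X)
        * egf (gaussianMoment a δ) := by
  ext n
  rw [PowerSeries.coeff_derivative, add_mul, map_add, PowerSeries.coeff_C_mul, mul_assoc,
    PowerSeries.coeff_C_mul, egf, PowerSeries.coeff_mk, PowerSeries.coeff_mk, gaussianMoment_succ,
    Nat.factorial_succ]
  rcases n with _ | n
  · simp
  · rw [PowerSeries.coeff_succ_X_mul, PowerSeries.coeff_mk, Nat.factorial_succ]
    push_cast
    field_simp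

/-- Flowing the moments of a heat kernel back to time `0` gives the moments of a point mass. -/
lemma coeff_heatSeries_neg_mul_egf_gaussianMoment (a : ℝ) (δ : NNReal) (n : ℕ) :
    PowerSeries.coeff n (heatSeries (-δ) * egf (gaussianMoment a δ))
      = a ^ n / (n.factorial : ℝ) := by
  have hD : PowerSeries.derivative ℝ (heatSeries (-δ) * egf (gaussianMoment a δ))
      = PowerSeries.C a * (heatSeries (-δ) * egf (gaussianMoment a δ)) := by
    rw [Derivation.leibniz, derivative_heatSeries, derivative_egf_gaussianMoment, smul_eq_mul,
      smul_eq_mul, show 2 * -(δ : ℝ) = -(2 * δ) by ring, map_neg]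
    ring
  induction n with
  | zero =>
    rw [PowerSeries.coeff_zero_eq_constantCoeff_apply, map_mul, constantCoeff_heatSeries,
      ← PowerSeries.coeff_zero_eq_constantCoeff_apply, egf, PowerSeries.coeff_mk,
      gaussianMoment_zero]
    simp
  | succ n ih =>
    have h1 := congrArg (PowerSeries.coeff n) hD
    rw [PowerSeries.coeff_derivative, PowerSeries.coeff_C_mul, ih] at h1
    rw [Nat.factorial_succ, pow_succ]
    push_cast
    field_simp at h1 ⊢
    linarith

/-- A sequence whose backward heat flow is given by an atomic measure consists of the moments of
the corresponding Gaussian mixture. -/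
lemma eq_sum_gaussianMoment {N M : ℕ} (hMN : M ≤ N) (s : Fin N → ℝ) (δ : NNReal) {k : ℕ}
    (c x : Fin k → ℝ)
    (h : ∀ α : Fin N, (α : ℕ) < M → heatFlow s (-δ) α = ∑ i, c i * x i ^ (α : ℕ))
    {n : ℕ} (hn : n < M) :
    extendSeq s n = ∑ i, c i * gaussianMoment (x i) δ n := by
  have hsum : egf (fun n => ∑ i, c i * gaussianMoment (x i) δ n)
      = ∑ i, PowerSeries.C (c i) * egf (gaussianMoment (x i) δ) := by
    ext m
    rw [map_sum, egf, PowerSeries.coeff_mk, Finset.sum_div]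
    refine Finset.sum_congr rfl fun i _ => ?_
    rw [PowerSeries.coeff_C_mul, egf, PowerSeries.coeff_mk, mul_div_assoc]
  refine eq_of_coeff_heatSeries_mul_egf_eq (t := -δ) (N := M)
    (w := fun n => ∑ i, c i * gaussianMoment (x i) δ n) (fun m hm => ?_) hn
  have h1 := h ⟨m, by omega⟩ hm
  rw [heatFlow_eq_coeff] at h1
  have hf : ((m.factorial : ℕ) : ℝ) ≠ 0 := by positivity
  refine mul_left_cancel₀ hf (h1.trans ?_)
  rw [hsum, Finset.mul_sum, map_sum, Finset.mul_sum]
  refine Finset.sum_congr rfl fun i _ => ?_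
  rw [mul_left_comm, PowerSeries.coeff_C_mul, coeff_heatSeries_neg_mul_egf_gaussianMoment]
  field_simp

lemma heatKernel_eq_gaussianPDFReal (δ : NNReal) (a x : ℝ) :
    heatKernel δ (x - a) = ProbabilityTheory.gaussianPDFReal a (2 * δ) x := by
  rw [heatKernel, ProbabilityTheory.gaussianPDFReal, one_div]
  push_cast
  rw [show 2 * Real.pi * (2 * (δ : ℝ)) = 4 * Real.pi * δ by ring,
    show 2 * (2 * (δ : ℝ)) = 4 * δ by ring, neg_div]

lemma gaussianMixture_eq_sum {δ : NNReal} (hδ : 0 < δ) {k : ℕ} {c : Fin k → ℝ}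
    (hc : ∀ i, 0 < c i) (x : Fin k → ℝ) :
    gaussianMixture δ c x
      = ∑ i, ENNReal.ofReal (c i) • ProbabilityTheory.gaussianReal (x i) (2 * δ) := by
  have hv : 2 * δ ≠ 0 := by positivity
  ext A hA
  rw [gaussianMixture, withDensity_apply _ hA, Measure.finsetSum_apply]
  simp only [heatKernel_eq_gaussianPDFReal]
  have h1 : ∀ y, ENNReal.ofReal
      (∑ i, c i * ProbabilityTheory.gaussianPDFReal (x i) (2 * δ) y)
        = ∑ i, ENNReal.ofReal (c i) * ProbabilityTheory.gaussianPDF (x i) (2 * δ) y := fun y => by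
    rw [ENNReal.ofReal_sum_of_nonneg fun i _ => mul_nonneg (hc i).le
      (ProbabilityTheory.gaussianPDFReal_nonneg _ _ _)]
    exact Finset.sum_congr rfl fun i _ => ENNReal.ofReal_mul (hc i).le
  simp only [h1]
  rw [lintegral_finsetSum _ fun i _ =>
    (ProbabilityTheory.measurable_gaussianPDF _ _).const_mul _]
  refine Finset.sum_congr rfl fun i _ => ?_
  rw [lintegral_const_mul _ (ProbabilityTheory.measurable_gaussianPDF _ _), Measure.smul_apply,
    ProbabilityTheory.gaussianReal_apply _ hv, smul_eq_mul]

lemma integrable_pow_gaussianReal (a : ℝ) (v : NNReal) (n : ℕ) :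
    Integrable (fun x : ℝ => x ^ n) (ProbabilityTheory.gaussianReal a v) :=
  ProbabilityTheory.integrable_pow_of_mem_interior_integrableExpSet (X := id) (by simp) n

lemma represents_gaussianMixture {δ : NNReal} (hδ : 0 < δ) {k : ℕ} {c : Fin k → ℝ}
    (hc : ∀ i, 0 < c i) (x : Fin k → ℝ) {N : ℕ} (s : Fin N → ℝ)
    (h : ∀ α : Fin N, s α = ∑ i, c i * gaussianMoment (x i) δ α) :
    Represents (gaussianMixture δ c x) s := by
  intro α
  have hint : ∀ i ∈ Finset.univ, Integrable (fun y : ℝ => y ^ (α : ℕ))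
      (ENNReal.ofReal (c i) • ProbabilityTheory.gaussianReal (x i) (2 * δ)) := fun i _ =>
    (integrable_pow_gaussianReal _ _ _).smul_measure ENNReal.ofReal_ne_top
  rw [gaussianMixture_eq_sum hδ hc]
  refine ⟨integrable_finsetSum_measure.2 hint, ?_⟩
  rw [integral_finsetSum_measure hint, h α]
  refine Finset.sum_congr rfl fun i _ => ?_
  rw [integral_smul_measure, ENNReal.toReal_ofReal (hc i).le, smul_eq_mul, gaussianMoment]

/-! ### The first time of degeneracy -/

/-- A continuous path of symmetric matrices that starts positive definite and does not stay so
is positive semidefinite and singular when it first stops being positive definite. -/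
lemma exists_isLeast_det_eq_zero {ι : Type*} [Fintype ι] [DecidableEq ι]
    {A : ℝ → Matrix ι ι ℝ} (hA : Continuous A) (hherm : ∀ t, (A t).IsHermitian)
    (h0 : (A 0).PosDef) (hT : ∃ t, 0 ≤ t ∧ ¬ (A t).PosDef) :
    ∃ δ : ℝ, IsLeast {t : ℝ | 0 < t ∧ (A t).det = 0} δ ∧ (A δ).PosSemidef ∧ (A δ).det = 0 := by
  have hq : Continuous fun z : ℝ × (ι → ℝ) => z.2 ⬝ᵥ (A z.1).mulVec z.2 :=
    continuous_snd.dotProduct ((hA.comp continuous_fst).matrix_mulVec continuous_snd)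
  have hnot : ∀ t, ¬ (A t).PosDef ↔ ∃ v : ι → ℝ, ‖v‖ = 1 ∧ v ⬝ᵥ (A t).mulVec v ≤ 0 := by
    intro t
    constructor
    · intro h
      by_contra! hcon
      refine h (.of_dotProduct_mulVec_pos (hherm t) fun v hv => ?_)
      have hv' : 0 < ‖v‖ := norm_pos_iff.2 hv
      have h1 := hcon (‖v‖⁻¹ • v) (by rw [norm_smul, norm_inv, norm_norm, inv_mul_cancel₀ hv'.ne'])
      rw [Matrix.mulVec_smul, smul_dotProduct, dotProduct_smul, smul_eq_mul, smul_eq_mul] at h1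
      rw [star_trivial]
      have h2 : 0 < ‖v‖⁻¹ := inv_pos.2 hv'
      exact pos_of_mul_pos_right (pos_of_mul_pos_right h1 h2.le) h2.le
    · rintro ⟨v, hv1, hv⟩ hp
      have hv0 : v ≠ 0 := by rintro rfl; simp at hv1
      have := hp.dotProduct_mulVec_pos hv0
      rw [star_trivial] at this
      linarith
  -- the failure of positive definiteness is a closed condition, by compactness of the sphere
  have hclosed : IsClosed {t : ℝ | 0 ≤ t ∧ ¬ (A t).PosDef} := by
    have hK : IsClosed {z : ℝ × Metric.sphere (0 : ι → ℝ) 1 |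
        (z.2 : ι → ℝ) ⬝ᵥ (A z.1).mulVec z.2 ≤ 0} :=
      isClosed_le (hq.comp (continuous_fst.prodMk (continuous_subtype_val.comp continuous_snd)))
        continuous_const
    have := (isClosedMap_fst_of_compactSpace _ hK).inter (isClosed_Ici (a := (0 : ℝ)))
    convert this using 1
    ext t
    simp only [Set.mem_ofPred_eq, hnot, Set.mem_inter_iff, Set.mem_image, Prod.exists,
      exists_and_right, exists_eq_right, Subtype.exists, mem_sphere_zero_iff_norm, exists_prop,
      Set.mem_Ici]
    tauto
  obtain ⟨t₀, ht₀⟩ := hT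
  have hbdd : BddBelow {t : ℝ | 0 ≤ t ∧ ¬ (A t).PosDef} := ⟨0, fun t ht => ht.1⟩
  set δ := sInf {t : ℝ | 0 ≤ t ∧ ¬ (A t).PosDef} with hδ
  obtain ⟨hδ0, hδn⟩ : δ ∈ {t : ℝ | 0 ≤ t ∧ ¬ (A t).PosDef} := hclosed.csInf_mem ⟨t₀, ht₀⟩ hbdd
  have hδpos : 0 < δ := lt_of_le_of_ne hδ0 fun h => hδn (h ▸ h0)
  have hbefore : ∀ t, 0 ≤ t → t < δ → (A t).PosDef := fun t ht htδ => by
    by_contra hn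
    exact absurd (csInf_le hbdd (show t ∈ {t : ℝ | 0 ≤ t ∧ ¬ (A t).PosDef} from ⟨ht, hn⟩))
      (not_le.2 htδ)
  have hsemi : (A δ).PosSemidef := by
    refine .of_dotProduct_mulVec_nonneg (hherm δ) fun v => ?_
    rw [star_trivial]
    have hc : Continuous fun t : ℝ => v ⬝ᵥ (A t).mulVec v :=
      hq.comp (continuous_id.prodMk continuous_const)
    have hsub : Set.Ico 0 δ ⊆ {t : ℝ | 0 ≤ v ⬝ᵥ (A t).mulVec v} := fun t ht => by
      have := (hbefore t ht.1 ht.2).posSemidef.dotProduct_mulVec_nonneg v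
      rwa [star_trivial] at this
    have := (isClosed_le continuous_const hc).closure_subset_iff.2 hsub
    rw [closure_Ico hδpos.ne] at this
    exact this (Set.right_mem_Icc.2 hδ0)
  have hdet : (A δ).det = 0 := by
    obtain ⟨v, hv1, hv⟩ := (hnot δ).1 hδn
    have hv0 : v ≠ 0 := by rintro rfl; simp at hv1
    have h1 := hsemi.dotProduct_mulVec_nonneg v
    refine Matrix.exists_mulVec_eq_zero_iff.1 ⟨v, hv0, ?_⟩
    rw [← hsemi.dotProduct_mulVec_zero_iff]
    rw [star_trivial] at h1 ⊢
    exact le_antisymm hv h1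
  refine ⟨δ, ⟨⟨hδpos, hdet⟩, fun t ht => ?_⟩, hsemi, hdet⟩
  by_contra hlt
  exact (hbefore t ht.1.le (not_le.1 hlt)).det_pos.ne' ht.2

lemma heatFlow_zero {N : ℕ} (s : Fin N → ℝ) : heatFlow s 0 = s := by
  ext α
  rw [heatFlow, heatPoly, eval_finsetSum, Finset.sum_eq_single 0]
  · simp only [eval_C, pow_zero, mul_one, mul_zero, Nat.sub_zero,
      Nat.factorial_zero, Nat.cast_one]
    rw [div_self (by positivity), one_mul]
  · intro i _ hi
    simp [hi]
  · simp

lemma heatFlow_two {N : ℕ} (s : Fin N → ℝ) (t : ℝ) (h : 2 < N) :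
    heatFlow s t ⟨2, h⟩ = s ⟨2, h⟩ + 2 * t * s ⟨0, by omega⟩ := by
  simp [heatFlow, heatPoly, Finset.sum_range_succ, Nat.factorial]
  ring

lemma continuous_hankel_heatFlow {m N : ℕ} (s : Fin N → ℝ) (h : 2 * m < N) :
    Continuous fun t : ℝ => hankel m (heatFlow s (-t)) h :=
  continuous_matrix fun a b =>
    (heatPoly s ⟨(a : ℕ) + (b : ℕ), by omega⟩).continuous.comp continuous_neg

/-- The backward heat flow does not stay positive definite: the second moment `s₂ - 2 t s₀`
vanishes at a positive time. -/
lemma exists_not_posDef_hankel_heatFlow {d N : ℕ} (s : Fin N → ℝ) (h : 2 * (d + 1) < N)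
    (hs : (hankel (d + 1) s h).PosDef) :
    ∃ t, 0 ≤ t ∧ ¬ (hankel (d + 1) (heatFlow s (-t)) h).PosDef := by
  have h0 : 0 < s ⟨0, by omega⟩ := hs.diag_pos (i := ⟨0, by omega⟩)
  have h2 : 0 < s ⟨2, by omega⟩ := hs.diag_pos (i := ⟨1, by omega⟩)
  refine ⟨s ⟨2, by omega⟩ / (2 * s ⟨0, by omega⟩), by positivity, fun hp => ?_⟩
  have h1 : 0 < heatFlow s (-(s ⟨2, by omega⟩ / (2 * s ⟨0, by omega⟩))) ⟨2, by omega⟩ :=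
    hp.diag_pos (i := ⟨1, by omega⟩)
  rw [heatFlow_two] at h1
  refine h1.ne' ?_
  field_simp
  ring

end HeatMoments

theorem mainTheorem6 (d j : ℕ) (hj : j = 0 ∨ j = 1) (s : Fin (2 * d + j + 1) → ℝ)
    (hs : (HeatMoments.hankel d s (by omega)).PosDef) :
    -- an extension with positive definite Hankel matrix can be chosen
    (∃ s' : Fin (2 * d + 3) → ℝ,
      (∀ α : Fin (2 * d + j + 1), s' (Fin.castLE (by omega) α) = s α) ∧
      (HeatMoments.hankel (d + 1) s' (by omega)).PosDef) ∧
    -- and for every such choice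
    (∀ s' : Fin (2 * d + 3) → ℝ,
      (∀ α : Fin (2 * d + j + 1), s' (Fin.castLE (by omega) α) = s α) →
      (HeatMoments.hankel (d + 1) s' (by omega)).PosDef →
      ∃ δ : ℝ,
        IsLeast {t : ℝ | 0 < t ∧
          (HeatMoments.hankel (d + 1) (HeatMoments.heatFlow s' (-t)) (by omega)).det = 0} δ ∧
        ∃ (k : ℕ) (c x : Fin k → ℝ),
          k ≤ d + 1 ∧ (∀ i, 0 < c i) ∧ Function.Injective x ∧
          HeatMoments.Represents (HeatMoments.gaussianMixture δ c x) s ∧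
          -- the centres are zeros of the polynomial of every kernel vector
          (∀ v : Fin (d + 1 + 1) → ℝ, v ≠ 0 →
            (HeatMoments.hankel (d + 1) (HeatMoments.heatFlow s' (-δ)) (by omega)).mulVec v = 0 →
            ∀ i, (HeatMoments.vecPoly v).eval (x i) = 0) ∧
          -- and exactly the (complex) zeros of the polynomial of some nonzero kernel vector
          (∃ v : Fin (d + 1 + 1) → ℝ, v ≠ 0 ∧
            (HeatMoments.hankel (d + 1) (HeatMoments.heatFlow s' (-δ)) (by omega)).mulVec v = 0 ∧
            ∀ z : ℂ, Polynomial.aeval z (HeatMoments.vecPoly v) = 0 ↔ ∃ i, z = (x i : ℂ))) := by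
  refine ⟨HeatMoments.exists_posDef_extension s (by omega) (by omega) hs, fun s' hs' hpd => ?_⟩
  obtain ⟨δ, hleast, hsemi, hdet⟩ := HeatMoments.exists_isLeast_det_eq_zero
    (HeatMoments.continuous_hankel_heatFlow s' (m := d + 1) (by omega))
    (fun t => HeatMoments.isHermitian_hankel _ _)
    (by rw [neg_zero, HeatMoments.heatFlow_zero]; exact hpd)
    (HeatMoments.exists_not_posDef_hankel_heatFlow s' (by omega) hpd)
  refine ⟨δ, hleast, ?_⟩
  set r := HeatMoments.heatFlow s' (-δ) with hr
  have hN : 2 * (d + 1) < 2 * d + 3 := by omega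
  set L := HeatMoments.riesz (HeatMoments.extendSeq r) with hLdef
  have hL : ∀ f : Polynomial ℝ, f.natDegree ≤ d + 1 → 0 ≤ L (f * f) := fun f hf => by
    have := hsemi.dotProduct_mulVec_nonneg fun i : Fin (d + 1 + 1) => f.coeff i
    rwa [star_trivial, HeatMoments.dotProduct_hankel_mulVec, HeatMoments.vecPoly_coeff f hf] at this
  obtain ⟨v₀, hv₀, hker⟩ := Matrix.exists_mulVec_eq_zero_iff.2 hdet
  obtain ⟨S, c, hS, hnode, hc, hquad, hzero⟩ := HeatMoments.exists_gauss_quadrature hL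
    ⟨_, HeatMoments.vecPoly_ne_zero hv₀, (HeatMoments.hankel_mulVec_eq_zero_iff r hN v₀).1 hker⟩
  -- enumerate the nodes
  let e := S.equivFin.symm
  have hsumS : ∀ F : ℝ → ℝ, ∑ a ∈ S, F a = ∑ i, F (e i) := fun F => by
    rw [← Finset.sum_coe_sort, Equiv.sum_comp e fun a : S => F a]
  have hδ : 0 < δ := hleast.1.1
  obtain ⟨δ', rfl⟩ : ∃ δ' : NNReal, δ = δ' := ⟨⟨δ, hδ.le⟩, rfl⟩
  refine ⟨S.card, fun i => c (e i), fun i => e i, hS, fun i => hc _ (e i).2,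
    Subtype.val_injective.comp e.injective, ?_, fun v _ hv i => ?_, ?_⟩
  -- only the orders up to `2 d + 1` are used here, as the quadrature may miss the order `2 d + 2`
  · refine HeatMoments.represents_gaussianMixture (by exact_mod_cast hδ)
      (fun i => hc _ (e i).2) _ s fun α => ?_
    have hα := α.2
    rw [← HeatMoments.eq_sum_gaussianMoment (M := 2 * d + 2) (by omega) s' δ' (fun i => c (e i))
      (fun i => (e i : ℝ)) (fun β hβ => ?_) (by omega),
      HeatMoments.extendSeq_of_lt s' (by omega), ← hs' α]
    · rfl
    · have h1 := hquad (Polynomial.X ^ (β : ℕ)) (by rw [Polynomial.natDegree_X_pow]; omega)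
      rw [hLdef, HeatMoments.riesz_X_pow, HeatMoments.extendSeq_of_lt r β.2] at h1
      rw [← hsumS fun a => c a * a ^ (β : ℕ)]
      simpa using h1
  · exact hzero _ ((HeatMoments.hankel_mulVec_eq_zero_iff r hN v).1 hv) _ (e i).2
  · set p : Polynomial ℝ := ∏ a ∈ S, (Polynomial.X - Polynomial.C a) with hp
    have hvp := HeatMoments.vecPoly_coeff p hnode.1
    have hp0 : p ≠ 0 := Finset.prod_ne_zero_iff.2 fun a _ => Polynomial.X_sub_C_ne_zero a
    refine ⟨fun i => p.coeff i, fun h0 => hp0 ?_, ?_, fun z => ?_⟩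
    · rw [← hvp, h0]; simp [HeatMoments.vecPoly]
    · rw [HeatMoments.hankel_mulVec_eq_zero_iff r hN, hvp]
      exact hnode
    · rw [hvp, hp, map_prod, Finset.prod_eq_zero_iff]
      constructor
      · rintro ⟨a, ha, hz⟩
        refine ⟨e.symm ⟨a, ha⟩, ?_⟩
        simp only [Equiv.apply_symm_apply]
        simpa [sub_eq_zero] using hz
      · rintro ⟨i, rfl⟩
        exact ⟨e i, (e i).2, by simp⟩
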